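/- For $\alpha,\beta\in\mathbb{R}$ and $x\in\mathbb{R}$ let $$\Gamma_\alpha(x)=\{(r,y): r>0,\ r^\alpha\leq 1,\ |y-x|\leq r^{1-\alpha}\},$$ and define the maximal operator $\mathcal{M}_{\alpha,\beta}$ by $$\mathcal{M}_{\alpha,\beta}f(x)=\sup_{(r,y)\in\Gamma_\alpha(x)}\frac{r^{2\beta}}{r}\int_{|y-z|\leq r}f(z)\,dz .$$ Let $1<p\leq q\leq\infty$ (with the convention $1/\infty=0$) and $\alpha,\beta\in\mathbb{R}$. If $\alpha>0$, then $\mathcal{M}_{\alpha,\beta}$ is bounded from $L^p(\mathbb{R})$ to $L^q(\mathbb{R})$ if and only if $$\beta\geq\frac{\alpha}{2q}+\frac12\Bigl(\frac1p-\frac1q\Bigr).$$ If $\alpha=0$, then $\mathcal{M}_{\alpha,\beta}$ is bounded from $L^p(\mathbb{R})$ to $L^q(\mathbb{R})$ if and only if $$\beta=\frac12\Bigl(\frac1p-\frac1q\Bigr).$$ If $\alpha<0$, then $\mathcal{M}_{\alpha,\beta}$ is bounded from $L^p(\mathbb{R})$ to $L^q(\mathbb{R})$ if and only if $$\beta\leq\frac{\alpha}{2q}+\frac12\Bigl(\frac1p-\frac1q\Bigr).$$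 Here "bounded from $L^p(\mathbb{R})$ to $L^q(\mathbb{R})$" means that there is a constant $C$ with $\|\mathcal{M}_{\alpha,\beta}f\|_{L^q(\mathbb{R})}\leq C\|f\|_{L^p(\mathbb{R})}$ for all real-valued $f\in L^p(\mathbb{R})$. -/

import Mathlib

open MeasureTheory
open scoped ENNReal NNReal

noncomputable section

namespace FractionalMaximal

/-- The region `Γ_α(x)` of pairs `(r, y)` in the upper half-plane (`r` is a radius, so `r > 0`)
with `r ^ α ≤ 1` and `|y - x| ≤ r ^ (1 - α)`. -/
def region (α x : ℝ) : Set (ℝ × ℝ) :=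
  {u | 0 < u.1 ∧ u.1 ^ α ≤ 1 ∧ |u.2 - x| ≤ u.1 ^ (1 - α)}

/-- The maximal operator
`𝓜_{α,β} f (x) = sup_{(r,y) ∈ Γ_α(x)} (r ^ (2β) / r) ∫_{|y - z| ≤ r} f(z) dz`.
The supremum is taken in the extended reals, as it may be infinite. -/
def maximalOp (α β : ℝ) (f : ℝ → ℝ) (x : ℝ) : EReal :=
  ⨆ u ∈ region α x, ((u.1 ^ (2 * β) / u.1 * ∫ z in {z : ℝ | |u.2 - z| ≤ u.1}, f z : ℝ) : EReal)

/-- An operator from functions on the line to extended real valued functions on the line is bounded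
from `L^p(ℝ)` to `L^q(ℝ)`: it maps `L^p` functions to measurable functions whose `L^q` norm is at
most a constant (independent of the function) times the `L^p` norm.
`EReal.abs` is the absolute value, with values in `[0, ∞]`. -/
def IsBoundedLpLq (T : (ℝ → ℝ) → ℝ → EReal) (p q : ℝ≥0∞) : Prop :=
  ∃ C : ℝ≥0, ∀ f : ℝ → ℝ, MemLp f p volume →
    AEMeasurable (T f) volume ∧
      eLpNorm (fun x => (T f x).abs) q volume ≤ C * eLpNorm f p volume

/-- The number `α / (2q) + (1/p - 1/q) / 2`, where `1/∞ = 0`. -/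
def criticalExponent (α : ℝ) (p q : ℝ≥0∞) : ℝ :=
  α * (q⁻¹).toReal / 2 + ((p⁻¹).toReal - (q⁻¹).toReal) / 2

end FractionalMaximal

end

namespace FractionalMaximal

open Set Filter Topology

/-! Write `A` for `avg f r y`, the integral of `|f|` over the ball divided by `r`, and `β_c` for
`criticalExponent`, so that `2 β_c = 1/p - (1 - α)/q`.

Sufficiency: for finite `q` the critical power splits as `(r^(2β_c) A)^q = (r^(1/p) A)^(q-p) * (r^α
A^p)`. Hölder bounds the first factor by a constant times `‖f‖_p^(q-p)` (`rpow_mul_avg_le`), so it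
remains to integrate the supremum of `r^α A^p` over the region (`exists_strong_bound`). For `q = ∞`
Hölder alone suffices.

For `α ≠ 0` that supremum is dominated by a sum over dyadic radii `2^j`, with weights `2^(jα)`. A
Vitali family covers all balls with average above `t`, and its radii add up to at most `(2/t) ∫_{|f|
> t/4} |f|`. A ball of radius `ρ` in the family contributes at most a multiple of `2^(jα) (ρ +
2^(j(1-α))) = 2^(jα) ρ + 2^j` at scale `j`, and only when `2^j ≤ 4ρ`. The condition `r^α ≤ 1`
truncates the first geometric series and `2^j ≤ 4ρ` the second, so the sum over `j` is `O(ρ)`.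
Integrating the resulting weak bound in `t` gives the strong one. For `α = 0` the first series
diverges, but the operator is then controlled by the uncentred Hardy–Littlewood maximal function.

Necessity: testing on the indicator of `[-r, r]` bounds `r^(2(β - β_c))` over all admissible `r`
(`exists_rpow_le_of_isBoundedLpLq`). These are `r ≤ 1`, all `r > 0`, or `r ≥ 1` according to the
sign of `α`. -/

/-! ### Geometric series and layer cake formulas. -/

/-- A bilateral geometric series, truncated where its terms exceed `B`, is at most a multiple
of `B`. -/
theorem exists_tsum_two_rpow_le {γ : ℝ} (hγ : γ ≠ 0) :
    ∃ C : ℝ≥0, ∀ B : ℝ, 0 ≤ B →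
      ∑' j : ℤ, (if (2 : ℝ) ^ (j * γ) ≤ B then ENNReal.ofReal ((2 : ℝ) ^ (j * γ)) else 0)
        ≤ C * ENNReal.ofReal B := by
  set ρ : ℝ := (2 : ℝ) ^ (-|γ|) with hρ
  have hρ0 : 0 < ρ := by positivity
  have hρ1 : ρ < 1 := Real.rpow_lt_one_of_one_lt_of_neg (by norm_num) (by simpa using hγ)
  have hgeo := summable_geometric_of_lt_one hρ0.le hρ1
  refine ⟨(∑' n : ℕ, ρ ^ n).toNNReal, fun B hB => ?_⟩
  change _ ≤ ENNReal.ofReal _ * _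
  rw [ENNReal.tsum_eq_iSup_sum, ← ENNReal.ofReal_mul (tsum_nonneg fun n => by positivity)]
  refine iSup_le fun s => ?_
  rw [← Finset.sum_filter, ← ENNReal.ofReal_sum_of_nonneg (fun i _ => by positivity)]
  refine ENNReal.ofReal_le_ofReal ?_
  set s' := s.filter fun j : ℤ => (2 : ℝ) ^ (j * γ) ≤ B
  rcases s'.eq_empty_or_nonempty with h | h
  · rw [h, Finset.sum_empty]
    exact mul_nonneg (tsum_nonneg fun n => by positivity) hB
  -- The largest term sits at `k`, and the others are `ρ ^ |k - j|` times it. All indices of `s'`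
  -- lie on one side of `k`, so distinct `j` give distinct powers of `ρ`.
  obtain ⟨k, hk, hmax⟩ := s'.exists_max_image (fun j : ℤ => (j : ℝ) * γ) h
  have hkB : (2 : ℝ) ^ (k * γ) ≤ B := (Finset.mem_filter.1 hk).2
  have habs : ∀ j ∈ s', ((k - j).natAbs : ℝ) * |γ| = k * γ - j * γ := by
    intro j hj
    rw [Nat.cast_natAbs, Int.cast_abs, ← abs_mul, Int.cast_sub, sub_mul,
      abs_of_nonneg (sub_nonneg.2 (hmax j hj))]
  have hterm : ∀ j ∈ s', (2 : ℝ) ^ (j * γ) = 2 ^ (k * γ) * ρ ^ (k - j).natAbs := by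
    intro j hj
    rw [hρ, ← Real.rpow_natCast, ← Real.rpow_mul (by norm_num), ← Real.rpow_add (by norm_num)]
    congr 1
    linarith [habs j hj]
  have hinj : Set.InjOn (fun j : ℤ => (k - j).natAbs) s' := by
    intro i hi j hj hij
    have h1 := habs i hi
    have h2 := habs j hj
    simp only at hij
    rw [hij, h2] at h1
    have : (i : ℝ) * γ = j * γ := by linarith
    exact_mod_cast mul_right_cancel₀ hγ this
  rw [Finset.sum_congr rfl hterm, ← Finset.mul_sum,
    ← Finset.sum_image (f := fun n : ℕ => ρ ^ n) hinj, mul_comm]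
  exact mul_le_mul (hgeo.sum_le_tsum _ fun n _ => by positivity) hkB (by positivity)
    (tsum_nonneg fun n => by positivity)

/-- Layer cake bound for extended nonnegative functions. -/
theorem lintegral_rpow_le_lintegral_meas_lt {α : Type*} [MeasurableSpace α] {μ : Measure α}
    {m : α → ℝ≥0∞} (hm : Measurable m) {p : ℝ} (hp : 0 < p) :
    ∫⁻ a, m a ^ p ∂μ ≤ ENNReal.ofReal p *
      ∫⁻ t in Ioi (0 : ℝ), μ {a | ENNReal.ofReal t < m a} * ENNReal.ofReal (t ^ (p - 1)) := by
  -- The value `∞` is handled by monotone convergence: the formula is applied to the finite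
  -- truncations `min (m a) n`.
  have hmono : ∀ a, Monotone fun n : ℕ => min (m a) n := fun a i j hij =>
    min_le_min_left _ (by exact_mod_cast hij)
  have hlim : ∀ a, Tendsto (fun n : ℕ => min (m a) n) atTop (𝓝 (m a)) := fun a => by
    have := (tendsto_const_nhds (x := m a)).min ENNReal.tendsto_nat_nhds_top
    simpa using this
  have hT := lintegral_tendsto_of_tendsto_of_monotone (μ := μ)
    (f := fun n a => min (m a) (n : ℝ≥0∞) ^ p) (F := fun a => m a ^ p)
    (fun n => ((hm.min measurable_const).pow_const p).aemeasurable)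
    (ae_of_all _ fun a i j hij => ENNReal.rpow_le_rpow (hmono a hij) hp.le)
    (ae_of_all _ fun a => (ENNReal.continuous_rpow_const.tendsto _).comp (hlim a))
  refine le_of_tendsto' hT fun n => ?_
  have hfin : ∀ a, min (m a) (n : ℝ≥0∞) ≠ ∞ := fun a =>
    ne_top_of_le_ne_top (ENNReal.natCast_ne_top n) (min_le_right _ _)
  have heq := lintegral_rpow_eq_lintegral_meas_lt_mul μ
    (f := fun a => (min (m a) (n : ℝ≥0∞)).toReal)
    (ae_of_all _ fun a => ENNReal.toReal_nonneg)
    (hm.min measurable_const).ennreal_toReal.aemeasurable hp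
  have hl : ∀ a, ENNReal.ofReal ((min (m a) (n : ℝ≥0∞)).toReal ^ p) =
      min (m a) (n : ℝ≥0∞) ^ p := fun a => by
    rw [← ENNReal.ofReal_rpow_of_nonneg ENNReal.toReal_nonneg hp.le,
      ENNReal.ofReal_toReal (hfin a)]
  simp_rw [hl] at heq
  rw [heq]
  gcongr ENNReal.ofReal p * ?_
  refine setLIntegral_mono' measurableSet_Ioi fun t (ht : 0 < t) => ?_
  gcongr with a
  intro h
  exact ((ENNReal.ofReal_lt_iff_lt_toReal ht.le (hfin a)).2 h).trans_le (min_le_left _ _)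

/-- The integral of `|f|` over the set where `|f| > t / 4`. -/
noncomputable def tail (f : ℝ → ℝ) (t : ℝ) : ℝ≥0∞ := ∫⁻ z in {z | t / 4 < |f z|}, ‖f z‖ₑ

/-- This is the layer cake formula with exponent `p - 1` for the function `4 |f|` and the measure
`|f| dz`, whose distribution function is exactly `tail f`. -/
theorem lintegral_tail_mul_rpow {f : ℝ → ℝ} (hf : Measurable f) {p : ℝ} (hp : 1 < p) :
    ENNReal.ofReal (p - 1) * ∫⁻ t in Ioi (0 : ℝ), tail f t * ENNReal.ofReal (t ^ (p - 2)) =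
      ENNReal.ofReal (4 ^ (p - 1)) * ∫⁻ z, ‖f z‖ₑ ^ p := by
  have hp0 : 0 < p - 1 := by linarith
  have heq := lintegral_rpow_eq_lintegral_meas_lt_mul (volume.withDensity fun z => ‖f z‖ₑ)
    (f := fun z => 4 * |f z|) (ae_of_all _ fun z => by positivity)
    (by fun_prop) hp0
  have hset : ∀ t : ℝ, (volume.withDensity fun z => ‖f z‖ₑ) {z | t < 4 * |f z|} = tail f t := by
    intro t
    rw [withDensity_apply _ (measurableSet_lt measurable_const (by fun_prop)), tail]
    congr 3
    ext z
    constructor <;> intro h <;> linarith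
  simp_rw [hset] at heq
  rw [show p - 2 = p - 1 - 1 by ring, ← heq, lintegral_withDensity_eq_lintegral_mul _ (by fun_prop)
    (by fun_prop), ← lintegral_const_mul _ (by fun_prop)]
  refine lintegral_congr fun z => ?_
  simp only [Pi.mul_apply]
  rw [Real.mul_rpow (by norm_num) (abs_nonneg _), ENNReal.ofReal_mul (by positivity),
    ← ENNReal.ofReal_rpow_of_nonneg (abs_nonneg _) hp0.le, ← Real.norm_eq_abs, ofReal_norm]
  conv_rhs => rw [show p = 1 + (p - 1) by ring, ENNReal.rpow_add_of_nonneg _ _ zero_le_one hp0.le,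
    ENNReal.rpow_one]
  simp only [add_sub_cancel_left]
  ring

/-- A weak type bound in terms of the tails of `f`, for a weighted family of functions, implies
the corresponding strong type bound. -/
theorem tsum_lintegral_rpow_le {ι : Type*} [Countable ι] {f : ℝ → ℝ} (hf : Measurable f)
    {p : ℝ} (hp : 1 < p) {m : ι → ℝ → ℝ≥0∞} (hm : ∀ j, Measurable (m j)) (w : ι → ℝ≥0∞) (C : ℝ≥0)
    (H : ∀ t : ℝ, 0 < t → ∑' j, w j * volume {x | ENNReal.ofReal t < m j x} ≤
      C * (ENNReal.ofReal t)⁻¹ * tail f t) :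
    ∑' j, w j * ∫⁻ x, m j x ^ p ≤
      (ENNReal.ofReal p * C * (ENNReal.ofReal (p - 1))⁻¹ * ENNReal.ofReal (4 ^ (p - 1))) *
        ∫⁻ z, ‖f z‖ₑ ^ p := by
  have hp0 : 0 < p - 1 := by linarith
  have hanti : ∀ j, Measurable fun t : ℝ => volume {x | ENNReal.ofReal t < m j x} := fun j =>
    Antitone.measurable fun s t hst => measure_mono fun x hx =>
      (ENNReal.ofReal_le_ofReal hst).trans_lt hx
  have htail : Measurable (tail f) := Antitone.measurable fun s t hst =>
    lintegral_mono_set fun x (hx : t / 4 < _) => show s / 4 < _ by linarith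
  calc ∑' j, w j * ∫⁻ x, m j x ^ p
      ≤ ∑' j, w j * (ENNReal.ofReal p * ∫⁻ t in Ioi (0 : ℝ),
          volume {x | ENNReal.ofReal t < m j x} * ENNReal.ofReal (t ^ (p - 1))) := by
        gcongr with j
        exact lintegral_rpow_le_lintegral_meas_lt (hm j) (by linarith)
    _ = ENNReal.ofReal p * ∫⁻ t in Ioi (0 : ℝ),
          (∑' j, w j * volume {x | ENNReal.ofReal t < m j x}) * ENNReal.ofReal (t ^ (p - 1)) := by
        simp_rw [← ENNReal.tsum_mul_right]
        rw [lintegral_tsum fun j => by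
          have := hanti j
          fun_prop, ← ENNReal.tsum_mul_left]
        congr 1 with j
        simp_rw [mul_assoc]
        rw [lintegral_const_mul _ (by have := hanti j; fun_prop)]
        ring
    _ ≤ ENNReal.ofReal p * ∫⁻ t in Ioi (0 : ℝ),
          C * (tail f t * ENNReal.ofReal (t ^ (p - 2))) := by
        gcongr ENNReal.ofReal p * ?_
        refine setLIntegral_mono (by fun_prop) fun t (ht : 0 < t) => ?_
        calc _ ≤ C * (ENNReal.ofReal t)⁻¹ * tail f t * ENNReal.ofReal (t ^ (p - 1)) := by
              gcongr
              exact H t ht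
          _ = C * (tail f t * ((ENNReal.ofReal t)⁻¹ * ENNReal.ofReal (t ^ (p - 1)))) := by ring
          _ = _ := by
            rw [← ENNReal.ofReal_inv_of_pos ht, ← ENNReal.ofReal_mul (by positivity),
              ← Real.rpow_neg_one, ← Real.rpow_add ht]
            congr 4
            ring
    _ = _ := by
        rw [lintegral_const_mul _ (by fun_prop)]
        have h := lintegral_tail_mul_rpow hf hp
        have h0 : ENNReal.ofReal (p - 1) ≠ 0 := by simpa using hp0
        calc _ = ENNReal.ofReal p * C * ((ENNReal.ofReal (p - 1))⁻¹ * ENNReal.ofReal (p - 1)) *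
              ∫⁻ t in Ioi (0 : ℝ), tail f t * ENNReal.ofReal (t ^ (p - 2)) := by
              rw [ENNReal.inv_mul_cancel h0 ENNReal.ofReal_ne_top]
              ring
          _ = ENNReal.ofReal p * C * (ENNReal.ofReal (p - 1))⁻¹ * (ENNReal.ofReal (p - 1) *
              ∫⁻ t in Ioi (0 : ℝ), tail f t * ENNReal.ofReal (t ^ (p - 2))) := by ring
          _ = _ := by rw [h]; ring

/-! ### Averages over balls and the Vitali covering. -/

/-- The integral of `|f|` over `|y - z| ≤ r`, divided by `r`. -/
noncomputable def avg (f : ℝ → ℝ) (r y : ℝ) : ℝ≥0∞ :=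
  (ENNReal.ofReal r)⁻¹ * ∫⁻ z in {z | |y - z| ≤ r}, ‖f z‖ₑ

theorem setOf_abs_sub_le (y r : ℝ) : {z : ℝ | |y - z| ≤ r} = Metric.closedBall y r := by
  ext z
  rw [Metric.mem_closedBall, dist_comm, Real.dist_eq, mem_ofPred_eq]

/-- The ball has length `2r`, so the part of `f` with `|f| ≤ t / 4` contributes at most `rt / 2` to
an integral exceeding `rt`. The large values of `f` must supply the other half. -/
theorem radius_le_of_lt_avg {f : ℝ → ℝ} (hf : Measurable f) {t r y : ℝ} (ht : 0 < t) (hr : 0 < r)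
    (h : ENNReal.ofReal t < avg f r y) :
    ENNReal.ofReal r ≤ 2 * (ENNReal.ofReal t)⁻¹ *
      ∫⁻ z in Metric.closedBall y r, {z | t / 4 < |f z|}.indicator (fun z => ‖f z‖ₑ) z := by
  have hS : MeasurableSet {z | t / 4 < |f z|} := measurableSet_lt measurable_const (by fun_prop)
  set I := ∫⁻ z in Metric.closedBall y r, {z | t / 4 < |f z|}.indicator (fun z => ‖f z‖ₑ) z
  have hr0 : ENNReal.ofReal r ≠ 0 := by simpa using hr
  have ht0 : ENNReal.ofReal t ≠ 0 := by simpa using ht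
  have h1 : ENNReal.ofReal r * ENNReal.ofReal t < ENNReal.ofReal (r * t / 2) + I := by
    calc ENNReal.ofReal r * ENNReal.ofReal t
        < ENNReal.ofReal r * avg f r y := by
          rwa [ENNReal.mul_lt_mul_iff_right hr0 ENNReal.ofReal_ne_top]
      _ = ∫⁻ z in Metric.closedBall y r, ‖f z‖ₑ := by
          rw [avg, ← mul_assoc, ENNReal.mul_inv_cancel hr0 ENNReal.ofReal_ne_top, one_mul,
            setOf_abs_sub_le]
      _ ≤ ∫⁻ z in Metric.closedBall y r, (ENNReal.ofReal (t / 4) +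
            {z | t / 4 < |f z|}.indicator (fun z => ‖f z‖ₑ) z) := by
          refine lintegral_mono fun z => ?_
          by_cases hz : z ∈ {z | t / 4 < |f z|}
          · rw [indicator_of_mem hz]
            exact le_add_self
          · rw [indicator_of_notMem hz, add_zero, ← ofReal_norm]
            exact ENNReal.ofReal_le_ofReal (not_lt.1 hz)
      _ = ENNReal.ofReal (r * t / 2) + I := by
          rw [lintegral_add_left measurable_const, setLIntegral_const, Real.volume_closedBall,
            ← ENNReal.ofReal_mul (by positivity)]
          congr 2
          ring
  rw [show ENNReal.ofReal r * ENNReal.ofReal t = ENNReal.ofReal (r * t / 2) +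
    ENNReal.ofReal (r * t / 2) by
      rw [← ENNReal.ofReal_add (by positivity) (by positivity), ← ENNReal.ofReal_mul hr.le]
      congr 1
      ring] at h1
  have h2 := (ENNReal.add_lt_add_iff_left ENNReal.ofReal_ne_top).1 h1
  calc ENNReal.ofReal r = 2 * (ENNReal.ofReal t)⁻¹ * ENNReal.ofReal (r * t / 2) := by
        rw [← ENNReal.ofReal_inv_of_pos ht, show (2 : ℝ≥0∞) = ENNReal.ofReal 2 by simp,
          ← ENNReal.ofReal_mul (by norm_num), ← ENNReal.ofReal_mul (by positivity)]
        congr 1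
        field_simp
    _ ≤ _ := by gcongr

/-- A Vitali family of balls controlling all the balls on which the average exceeds `t`. -/
theorem exists_cover {f : ℝ → ℝ} (hf : Measurable f) {t : ℝ} (ht : 0 < t)
    (hfin : tail f t ≠ ∞) :
    ∃ u : Set (ℝ × ℝ), u.Countable ∧ (∀ b ∈ u, 0 < b.1) ∧
      ∑' b : u, ENNReal.ofReal b.1.1 ≤ 2 * (ENNReal.ofReal t)⁻¹ * tail f t ∧
      ∀ r y : ℝ, 0 < r → ENNReal.ofReal t < avg f r y →
        ∃ b ∈ u, r ≤ 4 * b.1 ∧ |y - b.2| ≤ 4 * b.1 := by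
  have hS : MeasurableSet {z | t / 4 < |f z|} := measurableSet_lt measurable_const (by fun_prop)
  set g : ℝ → ℝ≥0∞ := {z | t / 4 < |f z|}.indicator (fun z => ‖f z‖ₑ) with hg
  have htail : tail f t = ∫⁻ z, g z := (lintegral_indicator hS _).symm
  have ht0 : ENNReal.ofReal t ≠ 0 := by simpa using ht
  set T : Set (ℝ × ℝ) := {b | 0 < b.1 ∧ ENNReal.ofReal t < avg f b.1 b.2} with hT
  set M := 2 * (ENNReal.ofReal t)⁻¹ * tail f t with hM
  have hMfin : M ≠ ∞ :=
    ENNReal.mul_ne_top (ENNReal.mul_ne_top (by norm_num) (ENNReal.inv_ne_top.2 ht0)) hfin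
  have hle : ∀ b ∈ T, b.1 ≤ M.toReal := by
    intro b hb
    rw [← ENNReal.ofReal_le_iff_le_toReal hMfin]
    refine (radius_le_of_lt_avg hf ht hb.1 hb.2).trans ?_
    rw [hM, htail]
    gcongr
    exact Measure.restrict_le_self
  -- Any enlargement factor above `3` would do; `4` is the source of the factors `4` in the
  -- conclusion.
  obtain ⟨u, huT, hdisj, hcov⟩ := Vitali.exists_disjoint_subfamily_covering_enlargement_closedBall
    T (fun b => b.2) (fun b => b.1) M.toReal hle 4 (by norm_num)
  have hcount : u.Countable := hdisj.countable_of_nonempty_interior fun b hb => by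
    exact ⟨b.2, Metric.ball_subset_interior_closedBall (Metric.mem_ball_self (huT hb).1)⟩
  refine ⟨u, hcount, fun b hb => (huT hb).1, ?_, fun r y hr h => ?_⟩
  · calc ∑' b : u, ENNReal.ofReal b.1.1
        ≤ ∑' b : u, 2 * (ENNReal.ofReal t)⁻¹ * ∫⁻ z in Metric.closedBall b.1.2 b.1.1, g z :=
          ENNReal.tsum_le_tsum fun b =>
            radius_le_of_lt_avg hf ht (huT b.2).1 (huT b.2).2
      _ = 2 * (ENNReal.ofReal t)⁻¹ * ∫⁻ z in ⋃ b ∈ u, Metric.closedBall b.2 b.1, g z := by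
          rw [ENNReal.tsum_mul_left,
            lintegral_biUnion hcount (fun b _ => Metric.isClosed_closedBall.measurableSet) hdisj]
      _ ≤ M := by
          rw [hM, htail]
          gcongr
          exact Measure.restrict_le_self
  · obtain ⟨b, hb, hsub⟩ := hcov (r, y) ⟨hr, h⟩
    -- On the line, inclusion in the enlarged ball is read off at the two endpoints `y - r` and `y +
    -- r`.
    simp only [Real.closedBall_eq_Icc] at hsub
    have h1 := hsub (left_mem_Icc.2 (by linarith))
    have h2 := hsub (right_mem_Icc.2 (by linarith))
    refine ⟨b, hb, ?_, abs_le.2 ⟨?_, ?_⟩⟩ <;> linarith [h1.1, h1.2, h2.1, h2.2]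

/-! ### Continuity of averages and measurability of suprema. -/

theorem continuous_integral_abs_sub_le {f : ℝ → ℝ} (hf : LocallyIntegrable f) {r : ℝ}
    (hr : 0 < r) : Continuous fun y => ∫ z in {z : ℝ | |y - z| ≤ r}, f z := by
  have hint : ∀ a b, IntervalIntegrable f volume a b := fun a b =>
    (hf.integrableOn_isCompact isCompact_uIcc).intervalIntegrable
  have hF := intervalIntegral.continuous_primitive hint 0
  have heq : (fun y => ∫ z in {z : ℝ | |y - z| ≤ r}, f z) =
      fun y => (∫ z in (0 : ℝ)..(y + r), f z) - ∫ z in (0 : ℝ)..(y - r), f z := by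
    ext y
    rw [intervalIntegral.integral_interval_sub_left (hint _ _) (hint _ _),
      intervalIntegral.integral_of_le (by linarith), setOf_abs_sub_le, Real.closedBall_eq_Icc,
      integral_Icc_eq_integral_Ioc]
  rw [heq]
  exact (hF.comp (by fun_prop)).sub (hF.comp (by fun_prop))

theorem avg_eq_ofReal {f : ℝ → ℝ} (hf : LocallyIntegrable f) (r y : ℝ) :
    avg f r y = (ENNReal.ofReal r)⁻¹ *
      ENNReal.ofReal (∫ z in {z : ℝ | |y - z| ≤ r}, ‖f z‖) := by
  rw [avg, ofReal_integral_norm_eq_lintegral_enorm]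
  rw [setOf_abs_sub_le]
  exact hf.integrableOn_isCompact (isCompact_closedBall y r)

theorem continuous_avg {f : ℝ → ℝ} (hf : LocallyIntegrable f) {r : ℝ} (hr : 0 < r) :
    Continuous (avg f r) := by
  have : avg f r = fun y => (ENNReal.ofReal r)⁻¹ *
      ENNReal.ofReal (∫ z in {z : ℝ | |y - z| ≤ r}, ‖f z‖) := by
    ext y
    exact avg_eq_ofReal hf r y
  rw [this]
  refine ENNReal.continuous_const_mul (ENNReal.inv_ne_top.2 (by simpa using hr)) |>.comp ?_
  exact ENNReal.continuous_ofReal.comp (continuous_integral_abs_sub_le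
    (fun x => (hf x).imp fun _ h => ⟨h.1, h.2.norm⟩) hr)

/-- A supremum of a family of continuous functions over translated regions is measurable. -/
theorem measurable_iSup_translate {E : Type*} [CompleteLinearOrder E] [TopologicalSpace E]
    [OrderTopology E] [SecondCountableTopology E] [MeasurableSpace E] [BorelSpace E]
    (P : Set ℝ) (ρ : ℝ → ℝ) {F : ℝ → ℝ → E} (hF : ∀ r ∈ P, Continuous (F r)) :
    Measurable fun x => ⨆ u : ℝ × ℝ, ⨆ _ : u.1 ∈ P ∧ |u.2 - x| ≤ ρ u.1, F u.1 u.2 := by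
  -- The substitution `y = x + v` frees the index set from `x`. An uncountable supremum of
  -- continuous functions of `x` is then lower semicontinuous, hence measurable.
  have heq : (fun x => ⨆ u : ℝ × ℝ, ⨆ _ : u.1 ∈ P ∧ |u.2 - x| ≤ ρ u.1, F u.1 u.2) =
      fun x => ⨆ v : ℝ × ℝ, ⨆ _ : v.1 ∈ P ∧ |v.2| ≤ ρ v.1, F v.1 (x + v.2) := by
    ext x
    apply le_antisymm
    · refine iSup₂_le fun u hu => ?_
      refine le_iSup₂_of_le (u.1, u.2 - x) hu ?_
      simp
    · refine iSup₂_le fun v hv => ?_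
      exact le_iSup₂_of_le (v.1, x + v.2) (by simpa using hv) le_rfl
  rw [heq]
  refine LowerSemicontinuous.measurable (lowerSemicontinuous_biSup fun v hv => ?_)
  exact ((hF v.1 hv.1).comp (by fun_prop)).lowerSemicontinuous

/-- The supremum of the averages of `|f|` over radii in `P` and centres at distance at most `ρ r`
from `x`. -/
noncomputable def supAvg (f : ℝ → ℝ) (P : Set ℝ) (ρ : ℝ → ℝ) (x : ℝ) : ℝ≥0∞ :=
  ⨆ u : ℝ × ℝ, ⨆ _ : u.1 ∈ P ∧ |u.2 - x| ≤ ρ u.1, avg f u.1 u.2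

theorem measurable_supAvg {f : ℝ → ℝ} (hf : LocallyIntegrable f) {P : Set ℝ} (hP : ∀ r ∈ P, 0 < r)
    (ρ : ℝ → ℝ) : Measurable (supAvg f P ρ) :=
  measurable_iSup_translate P ρ fun r hr => continuous_avg hf (hP r hr)

/-! ### Weak and strong type bounds for the supremum of averages. -/

theorem rpow_dyadic_bounds {r a γ : ℝ} (ha : 0 < a) (h1 : a ≤ r) (h2 : r ≤ 2 * a) :
    r ^ γ ≤ 2 ^ |γ| * a ^ γ ∧ a ^ γ ≤ 2 ^ |γ| * r ^ γ := by
  have hr : 0 < r := ha.trans_le h1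
  rcases le_total 0 γ with h | h
  · rw [abs_of_nonneg h, ← Real.mul_rpow (by norm_num) ha.le, ← Real.mul_rpow (by norm_num) hr.le]
    exact ⟨Real.rpow_le_rpow hr.le h2 h, Real.rpow_le_rpow ha.le (by linarith) h⟩
  · have e : ∀ s : ℝ, 0 < s → (2 : ℝ) ^ |γ| * s ^ γ = (s / 2) ^ γ := fun s hs => by
      rw [abs_of_nonpos h, Real.rpow_neg (by norm_num), Real.div_rpow hs.le (by norm_num)]
      field_simp
    rw [e a ha, e r hr]
    exact ⟨Real.rpow_le_rpow_of_nonpos (by linarith) (by linarith) h,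
      Real.rpow_le_rpow_of_nonpos (by linarith) (by linarith) h⟩

/-- The admissible radii of dyadic size `2 ^ j`. -/
def dyadicRadii (α : ℝ) (j : ℤ) : Set ℝ :=
  {r | 0 < r ∧ r ^ α ≤ 1 ∧ (2 : ℝ) ^ (j : ℝ) ≤ r ∧ r ≤ 2 * 2 ^ (j : ℝ)}

/-- A point of the level set at scale `2^j` lies within `4ρ + 2^|1-α| 2^(j(1-α))` of the centre of a
covering ball of radius `ρ ≥ 2^j / 4`. Multiplying the length of that interval by `2^(jα)` gives the
two terms, each carrying the cutoff that makes it summable in `j`. -/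
theorem volume_supAvg_dyadicRadii_le {α : ℝ} {f : ℝ → ℝ} {t : ℝ} {u : Set (ℝ × ℝ)}
    (hu : u.Countable)
    (hcov : ∀ r y : ℝ, 0 < r → ENNReal.ofReal t < avg f r y →
        ∃ b ∈ u, r ≤ 4 * b.1 ∧ |y - b.2| ≤ 4 * b.1) (j : ℤ) :
    ENNReal.ofReal ((2 : ℝ) ^ (j * α)) *
        volume {x | ENNReal.ofReal t < supAvg f (dyadicRadii α j) (fun r => r ^ (1 - α)) x} ≤
      ∑' b : u, (8 * ENNReal.ofReal b.1.1 * (if (2 : ℝ) ^ (j * α) ≤ 2 ^ |α| then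
          ENNReal.ofReal ((2 : ℝ) ^ (j * α)) else 0) +
        2 * ENNReal.ofReal (2 ^ |1 - α|) * (if (2 : ℝ) ^ (j * (1 : ℝ)) ≤ 4 * b.1.1 then
          ENNReal.ofReal ((2 : ℝ) ^ (j * (1 : ℝ))) else 0)) := by
  set S := {x | ENNReal.ofReal t < supAvg f (dyadicRadii α j) (fun r => r ^ (1 - α)) x} with hS
  have hpos : (0 : ℝ) < 2 ^ (j : ℝ) := by positivity
  have key : ∀ x ∈ S, (2 : ℝ) ^ (j * α) ≤ 2 ^ |α| ∧ ∃ b ∈ u, (2 : ℝ) ^ (j : ℝ) ≤ 4 * b.1 ∧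
      |x - b.2| ≤ 4 * b.1 + 2 ^ |1 - α| * 2 ^ (j * (1 - α)) := by
    intro x hx
    simp only [hS, mem_ofPred_eq, supAvg, lt_iSup_iff] at hx
    obtain ⟨⟨r, y⟩, ⟨⟨hr, hrα, hr1, hr2⟩, hyx⟩, hlt⟩ := hx
    obtain ⟨b, hb, hb1, hb2⟩ := hcov r y hr hlt
    refine ⟨?_, b, hb, hr1.trans hb1, ?_⟩
    · rw [Real.rpow_mul (by norm_num)]
      refine (rpow_dyadic_bounds hpos hr1 hr2).2.trans ?_
      exact mul_le_of_le_one_right (by positivity) hrα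
    · have h := (rpow_dyadic_bounds (γ := 1 - α) hpos hr1 hr2).1
      rw [← Real.rpow_mul (by norm_num)] at h
      simp only at hyx
      rw [abs_sub_comm] at hyx
      calc |x - b.2| ≤ |x - y| + |y - b.2| := abs_sub_le _ _ _
        _ ≤ _ := by linarith
  -- If this fails, no radius of size `2^j` satisfies `r^α ≤ 1`, and the level set is empty.
  by_cases hj : (2 : ℝ) ^ (j * α) ≤ 2 ^ |α|
  swap
  · have : S = ∅ := eq_empty_of_forall_notMem fun x hx => hj (key x hx).1
    simp [this]
  simp only [if_pos hj]
  set R : ℝ × ℝ → ℝ := fun b => 4 * b.1 + 2 ^ |1 - α| * 2 ^ (j * (1 - α))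
  set B : ℝ × ℝ → Set ℝ := fun b => {x | (2 : ℝ) ^ (j : ℝ) ≤ 4 * b.1 ∧ |b.2 - x| ≤ R b}
  have hsub : S ⊆ ⋃ b ∈ u, B b := fun x hx => by
    obtain ⟨-, b, hb, h1, h2⟩ := key x hx
    exact mem_biUnion hb ⟨h1, by rwa [abs_sub_comm]⟩
  calc _ ≤ ENNReal.ofReal ((2 : ℝ) ^ (j * α)) * ∑' b : u, volume (B b) := by
        gcongr
        exact (measure_mono hsub).trans (measure_biUnion_le _ hu _)
    _ = ∑' b : u, ENNReal.ofReal ((2 : ℝ) ^ (j * α)) * volume (B b) := ENNReal.tsum_mul_left.symm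
    _ ≤ _ := by
        refine ENNReal.tsum_le_tsum fun b => ?_
        by_cases hb : (2 : ℝ) ^ (j : ℝ) ≤ 4 * b.1.1
        swap
        · have : B b = ∅ := eq_empty_of_forall_notMem fun x hx => hb hx.1
          simp [this]
        have hBb : B b = Metric.closedBall b.1.2 (R b) := by
          rw [← setOf_abs_sub_le]
          ext x
          exact ⟨fun h => h.2, fun h => ⟨hb, h⟩⟩
        have hb0 : 0 < b.1.1 := by linarith
        rw [mul_one, if_pos hb, hBb, Real.volume_closedBall]
        rw [show (8 : ℝ≥0∞) = ENNReal.ofReal 8 by simp, show (2 : ℝ≥0∞) = ENNReal.ofReal 2 by simp]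
        simp only [← ENNReal.ofReal_mul (show (0 : ℝ) ≤ 8 by norm_num),
          ← ENNReal.ofReal_mul (show (0 : ℝ) ≤ 2 by norm_num)]
        rw [← ENNReal.ofReal_mul (by positivity), ← ENNReal.ofReal_mul (by positivity),
          ← ENNReal.ofReal_mul (by positivity), ← ENNReal.ofReal_add (by positivity)
            (by positivity)]
        refine ENNReal.ofReal_le_ofReal (le_of_eq ?_)
        have e : (2 : ℝ) ^ (j : ℝ) = 2 ^ (j * α) * 2 ^ (j * (1 - α)) := by
          rw [← Real.rpow_add (by norm_num)]
          congr 1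
          ring
        rw [e]
        simp only [R]
        ring

/-- After exchanging the sums over scales and covering balls, each ball gives two truncated
geometric series, of ratios `2^α` and `2`, and costs `O(ρ)`. The first one needs `α ≠ 0`. -/
theorem exists_weak_bound {α : ℝ} (hα : α ≠ 0) : ∃ C : ℝ≥0, ∀ f : ℝ → ℝ, Measurable f →
    ∀ t : ℝ, 0 < t → ∑' j : ℤ, ENNReal.ofReal ((2 : ℝ) ^ (j * α)) *
        volume {x | ENNReal.ofReal t < supAvg f (dyadicRadii α j) (fun r => r ^ (1 - α)) x} ≤
      C * (ENNReal.ofReal t)⁻¹ * tail f t := by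
  obtain ⟨C₁, h₁⟩ := exists_tsum_two_rpow_le hα
  obtain ⟨C₂, h₂⟩ := exists_tsum_two_rpow_le one_ne_zero
  set K : ℝ≥0∞ := 8 * (C₁ * ENNReal.ofReal (2 ^ |α|)) +
    2 * ENNReal.ofReal (2 ^ |1 - α|) * (C₂ * 4) with hK
  have hKfin : K ≠ ∞ := by
    rw [hK]
    finiteness
  -- Adding `1` keeps the constant visibly nonzero, so that the bound is `∞` when the tail is
  -- infinite.
  refine ⟨(K * 2).toNNReal + 1, fun f hf t ht => ?_⟩
  by_cases hfin : tail f t = ∞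
  · rw [hfin, ENNReal.mul_top]
    · exact le_top
    · simp
  obtain ⟨u, hu, hu0, hsum, hcov⟩ := exists_cover hf ht hfin
  calc _ ≤ _ := ENNReal.tsum_le_tsum fun j => volume_supAvg_dyadicRadii_le hu hcov j
    _ = _ := ENNReal.tsum_comm
    _ ≤ ∑' b : u, K * ENNReal.ofReal b.1.1 := by
        refine ENNReal.tsum_le_tsum fun b => ?_
        rw [ENNReal.tsum_add, ENNReal.tsum_mul_left, ENNReal.tsum_mul_left]
        have hb := hu0 b b.2
        calc _ ≤ 8 * ENNReal.ofReal b.1.1 * (C₁ * ENNReal.ofReal (2 ^ |α|)) +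
              2 * ENNReal.ofReal (2 ^ |1 - α|) * (C₂ * ENNReal.ofReal (4 * b.1.1)) := by
              gcongr
              · exact h₁ _ (by positivity)
              · exact h₂ _ (by positivity)
          _ = _ := by
              rw [ENNReal.ofReal_mul (by norm_num), hK,
                show ENNReal.ofReal 4 = 4 by simp]
              ring
    _ ≤ K * (2 * (ENNReal.ofReal t)⁻¹ * tail f t) := by
        rw [ENNReal.tsum_mul_left]
        gcongr
    _ = (K * 2) * (ENNReal.ofReal t)⁻¹ * tail f t := by ring
    _ ≤ _ := by
        gcongr
        rw [ENNReal.coe_add, ENNReal.coe_toNNReal (by finiteness)]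
        exact le_self_add

/-- This replaces the dyadic bound when `α = 0`. Every point of the level set lies within `4ρ + 4ρ`
of the centre of a covering ball, so `32` is the length factor `16` times the factor `2` of the
covering. -/
theorem weak_bound_supAvg_Ioi {f : ℝ → ℝ} (hf : Measurable f) {t : ℝ} (ht : 0 < t) :
    volume {x | ENNReal.ofReal t < supAvg f (Ioi 0) (fun r => r) x} ≤
      (32 : ℝ≥0) * (ENNReal.ofReal t)⁻¹ * tail f t := by
  by_cases hfin : tail f t = ∞
  · rw [hfin, ENNReal.mul_top]
    · exact le_top
    · simp
  obtain ⟨u, hu, hu0, hsum, hcov⟩ := exists_cover hf ht hfin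
  have hsub : {x | ENNReal.ofReal t < supAvg f (Ioi 0) (fun r => r) x} ⊆
      ⋃ b ∈ u, Metric.closedBall b.2 (8 * b.1) := by
    intro x hx
    simp only [mem_ofPred_eq, supAvg, lt_iSup_iff] at hx
    obtain ⟨⟨r, y⟩, ⟨hr, hyx⟩, hlt⟩ := hx
    obtain ⟨b, hb, hb1, hb2⟩ := hcov r y hr hlt
    refine mem_biUnion hb ?_
    rw [Metric.mem_closedBall, Real.dist_eq]
    simp only at hyx
    rw [abs_sub_comm] at hyx
    calc |x - b.2| ≤ |x - y| + |y - b.2| := abs_sub_le _ _ _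
      _ ≤ _ := by linarith
  calc _ ≤ ∑' b : u, volume (Metric.closedBall b.1.2 (8 * b.1.1)) :=
        (measure_mono hsub).trans (measure_biUnion_le _ hu _)
    _ = ∑' b : u, 16 * ENNReal.ofReal b.1.1 := by
        refine tsum_congr fun b => ?_
        rw [Real.volume_closedBall, ← mul_assoc, ENNReal.ofReal_mul (by norm_num)]
        norm_num
    _ ≤ 16 * (2 * (ENNReal.ofReal t)⁻¹ * tail f t) := by
        rw [ENNReal.tsum_mul_left]
        gcongr
    _ = _ := by
        push_cast
        ring

/-- This is the endpoint `q = p` of the theorem at the critical exponent. For `α ≠ 0` the supremum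
over radii may be replaced by a sum over dyadic scales because the weak bound is already summed over
them. -/
theorem exists_strong_bound (α : ℝ) {p : ℝ} (hp : 1 < p) : ∃ C : ℝ≥0, ∀ f : ℝ → ℝ,
    Measurable f → LocallyIntegrable f →
    ∫⁻ x, ⨆ u ∈ region α x, ENNReal.ofReal (u.1 ^ α) * avg f u.1 u.2 ^ p ≤
      C * ∫⁻ z, ‖f z‖ₑ ^ p := by
  have hp0 : 0 < p := by linarith
  have hp1 : ENNReal.ofReal (p - 1) ≠ 0 := by simpa using hp
  rcases eq_or_ne α 0 with rfl | hα
  · set K : ℝ≥0∞ := ENNReal.ofReal p * (32 : ℝ≥0) * (ENNReal.ofReal (p - 1))⁻¹ *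
      ENNReal.ofReal (4 ^ (p - 1)) with hK
    have hKfin : K ≠ ∞ := by
      have := ENNReal.inv_ne_top.2 hp1
      rw [hK]
      finiteness
    refine ⟨K.toNNReal, fun f hf hloc => ?_⟩
    have h := tsum_lintegral_rpow_le hf hp (ι := Unit)
      (m := fun _ => supAvg f (Ioi 0) (fun r => r))
      (fun _ => measurable_supAvg hloc (fun r hr => hr) _) (fun _ => 1) 32
      (fun t ht => by simpa using weak_bound_supAvg_Ioi hf ht)
    rw [ENNReal.coe_toNNReal hKfin]
    simp only [one_mul, tsum_fintype, Finset.univ_unique, Finset.sum_singleton] at h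
    refine le_trans (lintegral_mono fun x => ?_) h
    refine iSup₂_le fun u hu => ?_
    rw [Real.rpow_zero, ENNReal.ofReal_one, one_mul]
    refine ENNReal.rpow_le_rpow ?_ hp0.le
    exact le_iSup₂_of_le (f := fun (u : ℝ × ℝ) (_ : u.1 ∈ Ioi (0 : ℝ) ∧ |u.2 - x| ≤ u.1) =>
      avg f u.1 u.2) u ⟨hu.1, by simpa using hu.2.2⟩ le_rfl
  · obtain ⟨C, hC⟩ := exists_weak_bound hα
    set K : ℝ≥0∞ := ENNReal.ofReal p * C * (ENNReal.ofReal (p - 1))⁻¹ *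
      ENNReal.ofReal (4 ^ (p - 1)) with hK
    have hKfin : ENNReal.ofReal (2 ^ |α|) * K ≠ ∞ := by
      have := ENNReal.inv_ne_top.2 hp1
      rw [hK]
      finiteness
    refine ⟨(ENNReal.ofReal (2 ^ |α|) * K).toNNReal, fun f hf hloc => ?_⟩
    set m : ℤ → ℝ → ℝ≥0∞ := fun j => supAvg f (dyadicRadii α j) (fun r => r ^ (1 - α)) with hmdef
    have hm : ∀ j, Measurable (m j) := fun j => measurable_supAvg hloc (fun r hr => hr.1) _
    have h := tsum_lintegral_rpow_le hf hp hm
      (fun j : ℤ => ENNReal.ofReal ((2 : ℝ) ^ (j * α))) C (hC f hf)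
    rw [ENNReal.coe_toNNReal hKfin]
    calc _ ≤ ∫⁻ x, ENNReal.ofReal (2 ^ |α|) *
          ∑' j : ℤ, ENNReal.ofReal ((2 : ℝ) ^ (j * α)) * m j x ^ p := by
          refine lintegral_mono fun x => iSup₂_le fun u hu => ?_
          set j := Int.log 2 u.1
          have hj1 : (2 : ℝ) ^ (j : ℝ) ≤ u.1 := by
            rw [Real.rpow_intCast]
            exact_mod_cast Int.zpow_log_le_self (b := 2) (by norm_num) hu.1
          have hj2 : u.1 ≤ 2 * (2 : ℝ) ^ (j : ℝ) := by
            rw [Real.rpow_intCast, mul_comm, ← zpow_add_one₀ (by norm_num)]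
            exact_mod_cast (Int.lt_zpow_succ_log_self (b := 2) (by norm_num) u.1).le
          have hmj : avg f u.1 u.2 ≤ m j x :=
            le_iSup₂_of_le (f := fun (u : ℝ × ℝ)
              (_ : u.1 ∈ dyadicRadii α j ∧ |u.2 - x| ≤ u.1 ^ (1 - α)) =>
              avg f u.1 u.2) u ⟨⟨hu.1, hu.2.1, hj1, hj2⟩, hu.2.2⟩ le_rfl
          calc _ ≤ ENNReal.ofReal (2 ^ |α|) * (ENNReal.ofReal ((2 : ℝ) ^ (j * α)) * m j x ^ p) := by
                rw [← mul_assoc, ← ENNReal.ofReal_mul (by positivity),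
                  Real.rpow_mul (by norm_num)]
                gcongr
                exact (rpow_dyadic_bounds (by positivity) hj1 hj2).1
            _ ≤ _ := by
                gcongr
                exact ENNReal.le_tsum (f := fun j : ℤ =>
                  ENNReal.ofReal ((2 : ℝ) ^ (j * α)) * m j x ^ p) j
      _ = ENNReal.ofReal (2 ^ |α|) *
          ∑' j : ℤ, ENNReal.ofReal ((2 : ℝ) ^ (j * α)) * ∫⁻ x, m j x ^ p := by
          rw [lintegral_const_mul _ (by fun_prop), lintegral_tsum fun j => by fun_prop]
          congr 2 with j
          rw [lintegral_const_mul _ (by fun_prop)]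
      _ ≤ _ := by
          rw [mul_assoc]
          gcongr

/-! ### Hölder's bound and sufficiency. -/

theorem rpow_mul_avg_le {f : ℝ → ℝ} (hf : Measurable f) {p : ℝ≥0∞} (hp : 1 ≤ p) {r : ℝ}
    (hr : 0 < r) (y : ℝ) :
    ENNReal.ofReal (r ^ (p⁻¹).toReal) * avg f r y ≤ 2 * eLpNorm f p volume := by
  set a := (p⁻¹).toReal with ha
  have ha0 : 0 ≤ a := ENNReal.toReal_nonneg
  have ha1 : a ≤ 1 := by
    have := ENNReal.toReal_mono (by norm_num) (ENNReal.inv_le_one.2 hp)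
    simpa [ha] using this
  have h := eLpNorm_le_eLpNorm_mul_rpow_measure_univ (μ := volume.restrict {z : ℝ | |y - z| ≤ r})
    hp hf.aestronglyMeasurable
  rw [eLpNorm_one_eq_lintegral_enorm, Measure.restrict_apply_univ, setOf_abs_sub_le,
    Real.volume_closedBall, ENNReal.toReal_one, div_one, one_div, ← ENNReal.toReal_inv, ← ha,
    ENNReal.ofReal_rpow_of_pos (by positivity), ← setOf_abs_sub_le] at h
  calc _ ≤ ENNReal.ofReal (r ^ a) * ((ENNReal.ofReal r)⁻¹ *
        (eLpNorm f p volume * ENNReal.ofReal ((2 * r) ^ (1 - a)))) := by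
        rw [avg]
        gcongr
        exact h.trans (mul_le_mul_left (eLpNorm_mono_measure _ Measure.restrict_le_self) _)
    _ = ENNReal.ofReal (2 ^ (1 - a)) * eLpNorm f p volume := by
        rw [← ENNReal.ofReal_inv_of_pos hr, mul_comm (eLpNorm f p volume), ← mul_assoc,
          ← mul_assoc, ← ENNReal.ofReal_mul (by positivity), ← ENNReal.ofReal_mul (by positivity)]
        congr 2
        rw [Real.mul_rpow (by norm_num) hr.le, Real.rpow_sub hr, Real.rpow_one]
        have : r ^ a ≠ 0 := by positivity
        field_simp
    _ ≤ _ := by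
        gcongr
        rw [show (2 : ℝ≥0∞) = ENNReal.ofReal 2 by simp]
        refine ENNReal.ofReal_le_ofReal ?_
        calc (2 : ℝ) ^ (1 - a) ≤ 2 ^ (1 : ℝ) :=
              Real.rpow_le_rpow_of_exponent_le (by norm_num) (by linarith)
          _ = 2 := Real.rpow_one 2

/-- Nonemptiness is essential: an empty supremum is `⊥`, whose absolute value is `∞`. One admissible
index also gives the lower bound `-S` for the supremum. -/
theorem ereal_abs_iSup_le {ι : Type*} {P : ι → Prop} {c : ι → ℝ} {S : ℝ≥0∞} (hne : ∃ i, P i)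
    (h : ∀ i, P i → ENNReal.ofReal |c i| ≤ S) :
    (⨆ i, ⨆ _ : P i, (c i : EReal)).abs ≤ S := by
  induction S with
  | top => exact le_top
  | coe s =>
    have h' : ∀ i, P i → |c i| ≤ s := fun i hi => by
      have := h i hi
      rwa [ENNReal.ofReal_le_iff_le_toReal ENNReal.coe_ne_top, ENNReal.coe_toReal] at this
    have h1 : (⨆ i, ⨆ _ : P i, (c i : EReal)) ≤ ((s : ℝ) : EReal) := iSup₂_le fun i hi =>
      EReal.coe_le_coe_iff.2 ((le_abs_self _).trans (h' i hi))
    obtain ⟨i, hi⟩ := hne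
    have h2 : ((-(s : ℝ) : ℝ) : EReal) ≤ ⨆ i, ⨆ _ : P i, (c i : EReal) :=
      le_iSup₂_of_le i hi (EReal.coe_le_coe_iff.2 (abs_le.1 (h' i hi)).1)
    generalize (⨆ i, ⨆ _ : P i, (c i : EReal)) = X at h1 h2
    induction X with
    | bot => exact absurd h2 (by simp)
    | top => exact absurd h1 (by simp)
    | coe x =>
      rw [EReal.abs_def, ENNReal.ofReal_le_iff_le_toReal ENNReal.coe_ne_top, ENNReal.coe_toReal]
      exact abs_le.2 ⟨EReal.coe_le_coe_iff.1 h2, EReal.coe_le_coe_iff.1 h1⟩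

theorem region_nonempty (α x : ℝ) : ∃ u, u ∈ region α x :=
  ⟨(1, x), by simp [region]⟩

theorem abs_maximalOp_le (α β : ℝ) {f : ℝ → ℝ} (hf : LocallyIntegrable f) (x : ℝ) {S : ℝ≥0∞}
    (h : ∀ u ∈ region α x, ENNReal.ofReal (u.1 ^ (2 * β)) * avg f u.1 u.2 ≤ S) :
    (maximalOp α β f x).abs ≤ S := by
  refine ereal_abs_iSup_le (region_nonempty α x) fun u hu => le_trans ?_ (h u hu)
  have hu0 : 0 < u.1 := hu.1
  rw [avg_eq_ofReal hf, ← ENNReal.ofReal_inv_of_pos hu0, ← ENNReal.ofReal_mul (by positivity),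
    ← ENNReal.ofReal_mul (by positivity)]
  refine ENNReal.ofReal_le_ofReal ?_
  rw [abs_mul, abs_of_nonneg (by positivity : 0 ≤ u.1 ^ (2 * β) / u.1), div_eq_mul_inv, mul_assoc]
  gcongr
  exact norm_integral_le_integral_norm f

theorem measurable_maximalOp (α β : ℝ) {f : ℝ → ℝ} (hf : LocallyIntegrable f) :
    Measurable (maximalOp α β f) := by
  have h := measurable_iSup_translate {r : ℝ | 0 < r ∧ r ^ α ≤ 1} (fun r => r ^ (1 - α))
    (F := fun r y => ((r ^ (2 * β) / r * ∫ z in {z : ℝ | |y - z| ≤ r}, f z : ℝ) : EReal))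
    (fun r hr => continuous_coe_real_ereal.comp
      (continuous_const.mul (continuous_integral_abs_sub_le hf hr.1)))
  convert h using 1
  ext x
  simp only [maximalOp, region, mem_ofPred_eq, and_assoc]

theorem maximalOp_congr_ae (α β : ℝ) {f g : ℝ → ℝ} (h : f =ᵐ[volume] g) :
    maximalOp α β f = maximalOp α β g := by
  ext x
  simp only [maximalOp]
  congr! 5 with u hu
  rw [integral_congr_ae (ae_restrict_of_ae h)]

/-- Boundedness for exponents that are dominated by the critical one on the admissible radii. -/
theorem isBoundedLpLq_maximalOp {p q : ℝ≥0∞} (hp : 1 < p) (hpq : p ≤ q) {α β : ℝ}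
    (H : ∀ r : ℝ, 0 < r → r ^ α ≤ 1 → r ^ (2 * β) ≤ r ^ (2 * criticalExponent α p q)) :
    IsBoundedLpLq (maximalOp α β) p q := by
  -- The operator only sees `f` through integrals, so `f` may be replaced by a measurable
  -- representative.
  suffices h : ∃ C : ℝ≥0, ∀ f : ℝ → ℝ, Measurable f → MemLp f p volume →
      eLpNorm (fun x => (maximalOp α β f x).abs) q volume ≤ C * eLpNorm f p volume by
    obtain ⟨C, hC⟩ := h
    refine ⟨C, fun f hf => ?_⟩
    obtain ⟨g, hg, hfg⟩ := hf.aestronglyMeasurable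
    have hgp : MemLp g p volume := hf.ae_eq hfg
    rw [maximalOp_congr_ae α β hfg, eLpNorm_congr_ae hfg]
    exact ⟨(measurable_maximalOp α β (hgp.locallyIntegrable hp.le)).aemeasurable,
      hC g hg.measurable hgp⟩
  rcases eq_or_ne q ∞ with rfl | hq
  -- For `q = ∞` twice the critical exponent is `1/p`, exactly the power in Hölder's bound.
  · refine ⟨2, fun f hf hfp => ?_⟩
    rw [eLpNorm_exponent_top]
    refine eLpNormEssSup_le_of_ae_enorm_bound (ae_of_all _ fun x => ?_)
    refine abs_maximalOp_le α β (hfp.locallyIntegrable hp.le) x fun u hu => ?_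
    refine le_trans ?_ (rpow_mul_avg_le hf hp.le hu.1 u.2)
    gcongr ENNReal.ofReal ?_ * _
    refine (H u.1 hu.1 hu.2.1).trans_eq ?_
    congr 1
    simp only [criticalExponent, ENNReal.inv_top, ENNReal.toReal_zero]
    ring
  · have hpt : p ≠ ∞ := ne_top_of_le_ne_top hq hpq
    have hp0 : p ≠ 0 := (zero_lt_one.trans hp).ne'
    have hq0 : q ≠ 0 := ((zero_lt_one.trans hp).trans_le hpq).ne'
    set P := p.toReal with hP
    set Q := q.toReal with hQ
    have hP1 : 1 < P := by
      have := (ENNReal.toReal_lt_toReal ENNReal.one_ne_top hpt).2 hp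
      simpa using this
    have hPQ : P ≤ Q := ENNReal.toReal_mono hq hpq
    have hP0 : 0 < P := by linarith
    have hQ0 : 0 < Q := by linarith
    obtain ⟨C, hC⟩ := exists_strong_bound α hP1
    set K : ℝ≥0∞ := (2 ^ (Q - P) * C) ^ (1 / Q) with hK
    have hKfin : K ≠ ∞ := by
      refine ENNReal.rpow_ne_top_of_nonneg (by positivity) (ENNReal.mul_ne_top ?_ ENNReal.coe_ne_top)
      exact ENNReal.rpow_ne_top_of_nonneg (by linarith) (by norm_num)
    refine ⟨K.toNNReal, fun f hf hfp => ?_⟩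
    rw [ENNReal.coe_toNNReal hKfin]
    have hloc := hfp.locallyIntegrable hp.le
    set N := eLpNorm f p volume with hN
    have hNP : ∫⁻ z, ‖f z‖ₑ ^ P = N ^ P := by
      rw [hN, eLpNorm_eq_lintegral_rpow_enorm_toReal hp0 hpt, ← ENNReal.rpow_mul, one_div,
        inv_mul_cancel₀ hP0.ne', ENNReal.rpow_one]
    -- The interpolation step: `Q - P` of the `Q` powers go to Hölder's bound and the remaining `P`
    -- to the strong bound, since `2 β_c Q = (Q - P) / P + α`.
    have hpt : ∀ x, (maximalOp α β f x).abs ^ Q ≤ (2 * N) ^ (Q - P) *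
        ⨆ u ∈ region α x, ENNReal.ofReal (u.1 ^ α) * avg f u.1 u.2 ^ P := by
      intro x
      rw [← ENNReal.le_rpow_inv_iff hQ0]
      refine abs_maximalOp_le α β hloc x fun u hu => ?_
      have hu0 : 0 < u.1 := hu.1
      rw [ENNReal.le_rpow_inv_iff hQ0]
      calc (ENNReal.ofReal (u.1 ^ (2 * β)) * avg f u.1 u.2) ^ Q
          ≤ (ENNReal.ofReal (u.1 ^ (2 * criticalExponent α p q)) * avg f u.1 u.2) ^ Q := by
            gcongr (ENNReal.ofReal ?_ * _) ^ Q
            exact H u.1 hu.1 hu.2.1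
        _ = (ENNReal.ofReal (u.1 ^ (p⁻¹).toReal) * avg f u.1 u.2) ^ (Q - P) *
            (ENNReal.ofReal (u.1 ^ α) * avg f u.1 u.2 ^ P) := by
            rw [ENNReal.mul_rpow_of_nonneg _ _ hQ0.le,
              ENNReal.mul_rpow_of_nonneg _ _ (sub_nonneg.2 hPQ),
              ENNReal.ofReal_rpow_of_pos (by positivity),
              ENNReal.ofReal_rpow_of_pos (by positivity), mul_mul_mul_comm,
              ← ENNReal.ofReal_mul (by positivity),
              ← ENNReal.rpow_add_of_nonneg _ _ (sub_nonneg.2 hPQ) hP0.le, sub_add_cancel,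
              ← Real.rpow_mul hu0.le, ← Real.rpow_mul hu0.le, ← Real.rpow_add hu0]
            congr 3
            simp only [criticalExponent, ENNReal.toReal_inv, ← hP, ← hQ]
            field_simp
            ring
        _ ≤ _ := by
            refine mul_le_mul' (ENNReal.rpow_le_rpow (rpow_mul_avg_le hf hp.le hu0 u.2)
              (sub_nonneg.2 hPQ)) ?_
            exact le_iSup₂_of_le (f := fun (u : ℝ × ℝ) (_ : u ∈ region α x) =>
              ENNReal.ofReal (u.1 ^ α) * avg f u.1 u.2 ^ P) u hu le_rfl
    -- Finiteness lets this constant leave the integral without measurability of the supremum.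
    have hNfin : (2 * N) ^ (Q - P) ≠ ∞ :=
      ENNReal.rpow_ne_top_of_nonneg (sub_nonneg.2 hPQ)
        (ENNReal.mul_ne_top (by norm_num) hfp.eLpNorm_ne_top)
    rw [eLpNorm_eq_lintegral_rpow_enorm_toReal hq0 hq]
    calc _ ≤ ((2 * N) ^ (Q - P) * (C * N ^ P)) ^ (1 / Q) := by
          gcongr
          refine (lintegral_mono hpt).trans ?_
          rw [lintegral_const_mul' _ _ hNfin, ← hNP]
          gcongr
          exact hC f hf hloc
      _ = K * N := by
          rw [ENNReal.mul_rpow_of_nonneg _ _ (sub_nonneg.2 hPQ), mul_mul_mul_comm,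
            ← ENNReal.rpow_add_of_nonneg _ _ (sub_nonneg.2 hPQ) hP0.le, sub_add_cancel,
            ENNReal.mul_rpow_of_nonneg _ _ (by positivity), ← ENNReal.rpow_mul N,
            mul_one_div_cancel hQ0.ne', ENNReal.rpow_one]

/-! ### Necessity by testing on indicators. -/

/-- For the indicator of `[-r, r]`, the pair `(r, 0)` is admissible at every `|x| ≤ r^(1-α)` and
gives the value `2 r^(2β)` there. Comparing norms yields `r^(2β) r^((1-α)/q) ≤ C' r^(1/p)`. -/
theorem exists_rpow_le_of_isBoundedLpLq {p q : ℝ≥0∞} (hp : 1 < p) (hpq : p ≤ q) {α β : ℝ}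
    (h : IsBoundedLpLq (maximalOp α β) p q) :
    ∃ C : ℝ, 0 ≤ C ∧ ∀ r : ℝ, 0 < r → r ^ α ≤ 1 → r ^ (2 * (β - criticalExponent α p q)) ≤ C := by
  obtain ⟨C, hC⟩ := h
  set a := (p⁻¹).toReal with ha
  set b := (q⁻¹).toReal with hb
  have hp0 : p ≠ 0 := (zero_lt_one.trans hp).ne'
  have hq0 : q ≠ 0 := ((zero_lt_one.trans hp).trans_le hpq).ne'
  refine ⟨C * 2 ^ a / (2 * 2 ^ b), by positivity, fun r hr hrα => ?_⟩
  set s : Set ℝ := Metric.closedBall 0 r with hs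
  have hsm : MeasurableSet s := Metric.isClosed_closedBall.measurableSet
  have hsv : volume s = ENNReal.ofReal (2 * r) := Real.volume_closedBall _ _
  have hf : MemLp (s.indicator fun _ => (1 : ℝ)) p volume :=
    memLp_indicator_const p hsm 1 (Or.inr (by rw [hsv]; exact ENNReal.ofReal_ne_top))
  have hbound := (hC _ hf).2
  set E : Set ℝ := Metric.closedBall 0 (r ^ (1 - α)) with hE
  have hEv : volume E = ENNReal.ofReal (2 * r ^ (1 - α)) := Real.volume_closedBall _ _
  have hlow : ∀ x, ‖E.indicator (fun _ => ENNReal.ofReal (2 * r ^ (2 * β))) x‖ₑ ≤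
      ‖(maximalOp α β (s.indicator fun _ => (1 : ℝ)) x).abs‖ₑ := by
    intro x
    simp only [enorm_eq_self]
    by_cases hx : x ∈ E
    swap
    · rw [indicator_of_notMem hx]
      exact zero_le
    rw [indicator_of_mem hx]
    have hmem : (r, (0 : ℝ)) ∈ region α x := by
      refine ⟨hr, hrα, ?_⟩
      rw [hE, Metric.mem_closedBall, dist_comm, Real.dist_eq] at hx
      exact hx
    have hval : ((2 * r ^ (2 * β) : ℝ) : EReal) ≤
        maximalOp α β (s.indicator fun _ => (1 : ℝ)) x := by
      refine le_iSup₂_of_le (r, (0 : ℝ)) hmem (EReal.coe_le_coe_iff.2 (le_of_eq ?_))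
      simp only
      rw [setOf_abs_sub_le, ← hs, setIntegral_indicator hsm, inter_self, setIntegral_const,
        measureReal_def, hsv, ENNReal.toReal_ofReal (by positivity), smul_eq_mul, mul_one]
      field_simp
    generalize maximalOp α β (s.indicator fun _ => (1 : ℝ)) x = X at hval
    induction X with
    | bot => exact le_top
    | top => exact le_top
    | coe y =>
      rw [EReal.abs_def]
      exact ENNReal.ofReal_le_ofReal ((EReal.coe_le_coe_iff.1 hval).trans (le_abs_self y))
  have hmain := (eLpNorm_mono_enorm hlow).trans hbound
  rw [eLpNorm_indicator_const' Metric.isClosed_closedBall.measurableSet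
      (by rw [hEv]; simpa using by positivity) hq0,
    eLpNorm_indicator_const' hsm (by rw [hsv]; simpa using hr) hp0, hEv, hsv, enorm_eq_self,
    one_div, one_div, ← ENNReal.toReal_inv, ← ENNReal.toReal_inv, ← ha, ← hb,
    enorm_one, one_mul, ENNReal.ofReal_rpow_of_pos (by positivity),
    ENNReal.ofReal_rpow_of_pos (by positivity), ← ENNReal.ofReal_coe_nnreal,
    ← ENNReal.ofReal_mul (by positivity), ← ENNReal.ofReal_mul (by positivity),
    ENNReal.ofReal_le_ofReal_iff (by positivity), Real.mul_rpow (by norm_num) (by positivity),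
    Real.mul_rpow (by norm_num) hr.le, ← Real.rpow_mul hr.le] at hmain
  have hexp : r ^ (2 * (β - criticalExponent α p q)) * r ^ a = r ^ (2 * β) * r ^ ((1 - α) * b) := by
    rw [← Real.rpow_add hr, ← Real.rpow_add hr]
    congr 1
    simp only [criticalExponent, ← ha, ← hb]
    ring
  rw [le_div_iff₀ (by positivity)]
  refine le_of_mul_le_mul_right ?_ (show 0 < r ^ a by positivity)
  calc _ = 2 * 2 ^ b * (r ^ (2 * (β - criticalExponent α p q)) * r ^ a) := by ring
    _ = 2 * r ^ (2 * β) * (2 ^ b * r ^ ((1 - α) * b)) := by rw [hexp]; ring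
    _ ≤ _ := hmain.trans_eq (by ring)

/-- A power with nonzero exponent takes a value larger than `C` at `(C + 1) ^ (1 / s)`. -/
theorem lt_rpow_inv_rpow {C s : ℝ} (hC : 0 ≤ C) (hs : s ≠ 0) : C < ((C + 1) ^ s⁻¹) ^ s := by
  rw [Real.rpow_inv_rpow (by linarith) hs]
  linarith

end FractionalMaximal

/-! ### The three cases. -/

theorem theorem4 (p q : ℝ≥0∞) (hp : 1 < p) (hpq : p ≤ q) (α β : ℝ) :
    (0 < α →
      (FractionalMaximal.IsBoundedLpLq (FractionalMaximal.maximalOp α β) p q ↔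
        FractionalMaximal.criticalExponent α p q ≤ β)) ∧
    (α = 0 →
      (FractionalMaximal.IsBoundedLpLq (FractionalMaximal.maximalOp α β) p q ↔
        β = ((p⁻¹).toReal - (q⁻¹).toReal) / 2)) ∧
    (α < 0 →
      (FractionalMaximal.IsBoundedLpLq (FractionalMaximal.maximalOp α β) p q ↔
        β ≤ FractionalMaximal.criticalExponent α p q)) := by
  refine ⟨fun hα => ⟨fun h => ?_, fun h => ?_⟩, fun hα => ⟨fun h => ?_, fun h => ?_⟩,
    fun hα => ⟨fun h => ?_, fun h => ?_⟩⟩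
  · by_contra! hlt
    obtain ⟨C, hC0, hC⟩ := FractionalMaximal.exists_rpow_le_of_isBoundedLpLq hp hpq h
    have hs : 2 * (β - FractionalMaximal.criticalExponent α p q) < 0 := by linarith
    -- The radius `(C + 1)^(1/s)`, with `s = 2(β - β_c)`, violates the bound. The sign of `s`
    -- decides on which side of `1` it lies: here `s < 0` makes it at most `1`, as admissibility for
    -- `α > 0` requires.
    have hle : (C + 1) ^ (2 * (β - FractionalMaximal.criticalExponent α p q))⁻¹ ≤ 1 :=
      Real.rpow_le_one_of_one_le_of_nonpos (by linarith) (inv_nonpos.2 hs.le)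
    exact (FractionalMaximal.lt_rpow_inv_rpow hC0 hs.ne).not_ge
      (hC _ (by positivity) (Real.rpow_le_one (by positivity) hle hα.le))
  · refine FractionalMaximal.isBoundedLpLq_maximalOp hp hpq fun r hr hrα => ?_
    have hr1 : r ≤ 1 := by
      by_contra! hr1
      exact (Real.one_lt_rpow hr1 hα).not_ge hrα
    exact Real.rpow_le_rpow_of_exponent_ge hr hr1 (by linarith)
  · subst hα
    by_contra hne
    obtain ⟨C, hC0, hC⟩ := FractionalMaximal.exists_rpow_le_of_isBoundedLpLq hp hpq h
    have hs : 2 * (β - FractionalMaximal.criticalExponent 0 p q) ≠ 0 := by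
      refine mul_ne_zero two_ne_zero (sub_ne_zero.2 ?_)
      simpa [FractionalMaximal.criticalExponent] using hne
    -- For `α = 0` every radius is admissible, so both signs of `s` are excluded at once.
    exact (FractionalMaximal.lt_rpow_inv_rpow hC0 hs).not_ge
      (hC _ (by positivity) (by simp))
  · refine FractionalMaximal.isBoundedLpLq_maximalOp hp hpq fun r hr hrα => le_of_eq ?_
    congr 2
    simp [FractionalMaximal.criticalExponent, hα, h]
  · by_contra! hlt
    obtain ⟨C, hC0, hC⟩ := FractionalMaximal.exists_rpow_le_of_isBoundedLpLq hp hpq h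
    have hs : 0 < 2 * (β - FractionalMaximal.criticalExponent α p q) := by linarith
    have hle : 1 ≤ (C + 1) ^ (2 * (β - FractionalMaximal.criticalExponent α p q))⁻¹ :=
      Real.one_le_rpow (by linarith) (inv_nonneg.2 hs.le)
    exact (FractionalMaximal.lt_rpow_inv_rpow hC0 hs.ne').not_ge
      (hC _ (by positivity) (Real.rpow_le_one_of_one_le_of_nonpos hle hα.le))
  · refine FractionalMaximal.isBoundedLpLq_maximalOp hp hpq fun r hr hrα => ?_
    have hr1 : 1 ≤ r := by
      by_contra! hr1
      exact (Real.one_lt_rpow_of_pos_of_lt_one_of_neg hr hr1 hα).not_ge hrα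
    exact Real.rpow_le_rpow_of_exponent_le hr1 (by linarith)
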